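/- Let $\mathcal X$ be a finite set of items, $n\in\mathbb N$, and let $\mathcal S$ be the collection of nonempty choice sets $s\subseteq\mathcal X$ with $|s|\le n$. An aggregation mechanism $M=(w,\varphi)$ consists of a weight $w$, a real function of finite sets of reals, and an embedding $\varphi$, a real function of a real number and a finite set of reals. It combines score functions $f=(f_1,\dots,f_\ell)$, $f_i:\mathcal X\to\mathbb R$, into $$g_f(x,s)=\langle w(s),\varphi(x,s)\rangle=\sum_{i=1}^{\ell} w(f_i(s))\,\varphi(f_i(x),f_i(s)),\qquad f_i(s)=\{f_i(z):z\in s\}$$ (and likewise on any other set of items). For a class $H$ of score functions let $\mathcal G^{(\ell)}_H=\{g_f: f\in H^\ell\}$. Assume that * $M$ is scale-invariant: there is an odd bijection $\Phi:\mathbb R\to\mathbb R$ with $g_{\alpha u}(x,s)=\Phi(\alpha)\,g_u(x,s)$ for all $\alpha>0$, all finite tuples $u$ of utilities on a finite item set, all sets $s$ of these items and all $x\in s$; * $M$ has a triple basis: there are $u_1,\dots,u_k\in\mathbb R^3$, viewed as utilities of three items $x_1,x_2,x_3$, with $g_u(x_1,\{x_1,x_2\})>g_u(x_2,\{x_1,x_2\})$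 and $g_u(x,s)=g_u(x',s)$ for every other $s\subseteq\{x_1,x_2,x_3\}$ and all $x,x'\in s$. For a distribution $D$ on $\mathcal S\times\mathcal X$ let $\varepsilon_D(g)=P_{(s,y)\sim D}\big(\operatorname{argmax}_{x\in s}g(x,s)\neq\{y\}\big)$ be the risk (a tie counts as an error), and let $\varepsilon^*_D(\mathcal G)=\min_{g\in\mathcal G}\varepsilon_D(g)$ be the approximation error of a class $\mathcal G$. Then there is $\ell_0$ such that for every $\ell\ge\ell_0$, every choice function $c:\mathcal S\to\mathcal X$ ($c(s)\in s$ for all $s$) and every distribution $D$ on $\mathcal S\times\mathcal X$ under which $y=c(s)$ almost surely: 1. $\varepsilon^*_D(\mathcal G^{(\ell)}_{H})=0$ if $H$ is the class of all functions $\mathcal X\to\mathbb R$; 2. if on every choice set the aggregated scores of $M$ depend continuously on the utilities of the items, then $\varepsilon^*_D(\mathcal G^{(\ell)}_{H})=0$ for every class $H\supseteq F_+$, in particular for $H=F_+$, where $F$ is any class of score functions that separates every choice set (for each $s\in\mathcal S$ some $f\in F$ satisfies $f(x)>f(x')$ for all $x\in s$, $x'\in\mathcal X\setminus s$), and $F_+=\{x\mapsto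 a(b(x),b'(x)) : b,b'\in F,\ a\in\mathcal N\}$, with $\mathcal N$ the class of networks with two inputs, two fully connected hidden layers of two units each with a sigmoidal activation $\sigma$ (limits $0$ and $1$ at $-\infty$ and $+\infty$), and an affine output. In each case the minimum defining $\varepsilon^*_D$ is attained. -/

import Mathlib

/-- The choice sets: all nonempty sets of at most `n` items from the item space `X`. -/
abbrev ChoiceSet (X : Type*) (n : ℕ) : Type _ :=
  {s : Finset X // s.Nonempty ∧ s.card ≤ n}

/-- A set-dependent aggregation mechanism, i.e. the functional form by which the scores
`f = (f₁, …, f_ℓ)` are combined into `g(x, s) = ⟨w(s), φ(x, s)⟩`. In each dimension the weight is a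
set function of the scores of the items of `s`, `w_i(s) = w (f_i(s))` with
`f_i(s) = {f_i(z) : z ∈ s}`, and the embedding is an item-centric set function,
`φ_i(x, s) = φ (f_i(x), f_i(s))`; for instance `φ (a, A) = μ (a - r A)` for a reference-point
function `r` and an evaluation function `μ`. -/
structure AggregationMechanism where
  /-- The weight `w`, a function of the set of scores. -/
  w : Finset ℝ → ℝ
  /-- The embedding `φ`, a function of the score of the item and the set of scores. -/
  φ : ℝ → Finset ℝ → ℝ

namespace AggregationMechanism

/-- The aggregator `g_f(x, s) = ⟨w(s), φ(x, s)⟩ = ∑ i, w (f_i(s)) * φ (f_i(x), f_i(s))`. -/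
noncomputable def agg (M : AggregationMechanism) {X : Type*} {ℓ : ℕ}
    (f : Fin ℓ → X → ℝ) (x : X) (s : Finset X) : ℝ :=
  ∑ i, M.w (s.image (f i)) * M.φ (f i x) (s.image (f i))

/-- Scale invariance: there is an invertible odd `Φ` with `g_{αu}(x, s) = Φ(α) g_u(x, s)` for every
`α > 0`, every number of utilities and every finite set of items. -/
def ScaleInvariant (M : AggregationMechanism) : Prop :=
  ∃ Φ : ℝ → ℝ, Function.Bijective Φ ∧ (∀ t, Φ (-t) = -Φ t) ∧
    ∀ α : ℝ, 0 < α → ∀ (m ℓ : ℕ) (u : Fin ℓ → Fin m → ℝ) (s : Finset (Fin m)), ∀ x ∈ s,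
      M.agg (α • u) x s = Φ α * M.agg u x s

/-- On every choice set the aggregated scores depend continuously on the utilities of the items. -/
def ContinuousInUtilities (M : AggregationMechanism) : Prop :=
  ∀ (m ℓ : ℕ) (s : Finset (Fin m)), ∀ x ∈ s,
    Continuous fun u : Fin ℓ → Fin m → ℝ => M.agg u x s

/-- `u = (u₁, …, u_k)`, `u_i ∈ ℝ³`, is a triple basis under `M` for the triple `(x₁, x₂, x₃)` (here
the items `0, 1, 2`): `x₁` is strictly preferred to `x₂` in `{x₁, x₂}`, and there is indifference on
every other choice set. -/
def IsTripleBasis (M : AggregationMechanism) {k : ℕ} (u : Fin k → Fin 3 → ℝ) : Prop :=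
  M.agg u 1 {0, 1} < M.agg u 0 {0, 1} ∧
    ∀ s : Finset (Fin 3), s ≠ {0, 1} → ∀ x ∈ s, ∀ x' ∈ s, M.agg u x s = M.agg u x' s

/-- The class `𝒢` of aggregators of dimension `ℓ` over a class `F` of item score functions. -/
def aggClass (M : AggregationMechanism) {X : Type*} (ℓ : ℕ) (F : Set (X → ℝ)) :
    Set (X → Finset X → ℝ) :=
  {g | ∃ f : Fin ℓ → X → ℝ, (∀ i, f i ∈ F) ∧ g = M.agg f}

end AggregationMechanism

/-- The score function `f` separates `s` if it scores every item of `s` strictly higher than every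
item outside `s`. -/
def Separates {X : Type*} (f : X → ℝ) (s : Finset X) : Prop :=
  ∀ x ∈ s, ∀ x' ∉ s, f x' < f x

/-- `F` is expressive for choice sets of size at most `n`: each of them is separated by a member. -/
def SeparatesChoiceSets {X : Type*} (F : Set (X → ℝ)) (n : ℕ) : Prop :=
  ∀ s : ChoiceSet X n, ∃ f ∈ F, Separates f s.1

/-- A sigmoidal activation, scaled to have the limits `0` and `1`. -/
def IsSigmoidal (σ : ℝ → ℝ) : Prop :=
  Filter.Tendsto σ Filter.atBot (nhds 0) ∧ Filter.Tendsto σ Filter.atTop (nhds 1)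

/-- The network with two inputs, two fully connected hidden layers of two units each with
activation `σ`, and an affine output. -/
def smallNet (σ : ℝ → ℝ) (A₁ : Matrix (Fin 2) (Fin 2) ℝ) (β₁ : Fin 2 → ℝ)
    (A₂ : Matrix (Fin 2) (Fin 2) ℝ) (β₂ : Fin 2 → ℝ) (a : Fin 2 → ℝ) (β : ℝ)
    (v : Fin 2 → ℝ) : ℝ :=
  a ⬝ᵥ (fun i => σ ((A₂.mulVec (fun j => σ ((A₁.mulVec v + β₁) j)) + β₂) i)) + β

/-- The enriched class `F₊ = {x ↦ a (b(x), b'(x)) : a a small network, b, b' ∈ F}`. -/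
def enrichedClass {X : Type*} (σ : ℝ → ℝ) (F : Set (X → ℝ)) : Set (X → ℝ) :=
  {f | ∃ (A₁ : Matrix (Fin 2) (Fin 2) ℝ) (β₁ : Fin 2 → ℝ) (A₂ : Matrix (Fin 2) (Fin 2) ℝ)
      (β₂ : Fin 2 → ℝ) (a : Fin 2 → ℝ) (β : ℝ), ∃ b ∈ F, ∃ b' ∈ F,
        f = fun x => smallNet σ A₁ β₁ A₂ β₂ a β ![b x, b' x]}

/-- The decision rule `h_g(s) = argmax_{x ∈ s} g(x, s)`, as the set of all maximizers. -/
def decision {X : Type*} (g : X → Finset X → ℝ) (s : Finset X) : Set X :=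
  {x | x ∈ s ∧ ∀ x' ∈ s, g x' s ≤ g x s}

open Classical in
/-- The 0/1 loss. A tie counts as an error: there is no loss only if `y` is the unique maximizer. -/
noncomputable def zeroOneLoss {X : Type*} (g : X → Finset X → ℝ) (s : Finset X) (y : X) : ℝ :=
  if decision g s = {y} then 0 else 1

/-- The expected risk of `g` when `(s, y)` is drawn from `D`. -/
noncomputable def risk {X : Type*} [Fintype X] {n : ℕ} (D : PMF (ChoiceSet X n × X))
    (g : X → Finset X → ℝ) : ℝ :=
  ∑ p : ChoiceSet X n × X, (D p).toReal * zeroOneLoss g p.1.1 p.2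

/-- The approximation error of the class `G` under `D`: the least expected risk over `G`. -/
noncomputable def approxError {X : Type*} [Fintype X] {n : ℕ} (D : PMF (ChoiceSet X n × X))
    (G : Set (X → Finset X → ℝ)) : ℝ :=
  sInf (risk D '' G)

/-! For each choice set `s`, pull the triple basis back along the roles chosen, rejected, absent
relative to `s`. The resulting scores are indifferent on every `t ⊄ s`, favour `c s` on `s` by the
fixed gap `δ` of the basis, and err by at most `δ` on proper subsets of `s`. Scale invariance lets
the block of `s` be multiplied by any weight `W s > 0`; if `W t` exceeds the total weight of the
proper supersets of `t`, the block of `t` decides on `t` (`exists_realization`). Constant padding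
changes no differences, so `ℓ₀ = #(choice sets) * k` works for every `c`.

For part 2, role-dependent scores are pointwise limits of small networks
(`exists_tendsto_enrichedClass`), and finitely many strict preferences survive a small perturbation
when aggregation is continuous. -/

open Filter Topology

/-! ### Rescaling and concatenation of scores -/

namespace AggregationMechanism

variable (M : AggregationMechanism)

/-- Aggregation commutes with pulling utilities back along a map of items. -/
lemma agg_comp {X Y : Type*} [DecidableEq Y] {ℓ : ℕ} (f : Fin ℓ → Y → ℝ) (p : X → Y) (x : X)
    (s : Finset X) : M.agg (fun i => f i ∘ p) x s = M.agg f (p x) (s.image p) := by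
  simp [agg, Finset.image_image]

/-- The factor of a scale-invariant mechanism with some nonzero score is positive at positive
arguments. -/
lemma ScaleInvariant.pos_factor {M : AggregationMechanism} {Φ : ℝ → ℝ}
    (hbij : Function.Bijective Φ) (hodd : ∀ t, Φ (-t) = -Φ t)
    (hΦ : ∀ α : ℝ, 0 < α → ∀ (m ℓ : ℕ) (u : Fin ℓ → Fin m → ℝ) (s : Finset (Fin m)), ∀ x ∈ s,
      M.agg (α • u) x s = Φ α * M.agg u x s)
    {m ℓ : ℕ} {u : Fin ℓ → Fin m → ℝ} {s : Finset (Fin m)} {x : Fin m} (hx : x ∈ s)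
    (hne : M.agg u x s ≠ 0) {α : ℝ} (hα : 0 < α) : 0 < Φ α := by
  have h0 : Φ 0 = 0 := by
    have h := hodd 0
    rw [neg_zero] at h
    linarith
  have hr : 0 < √α := Real.sqrt_pos.2 hα
  -- Scaling twice by `√α` makes `Φ α` a square; it is nonzero because `Φ` is injective with `Φ 0 =
  -- 0`.
  have hsq : Φ α = Φ (√α) * Φ (√α) := by
    have h1 := hΦ α hα m ℓ u s x hx
    have h2 := hΦ (√α) hr m ℓ (√α • u) s x hx
    rw [smul_smul, Real.mul_self_sqrt hα.le, hΦ (√α) hr m ℓ u s x hx, h1, ← mul_assoc] at h2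
    exact mul_right_cancel₀ hne h2
  have hr0 : Φ (√α) ≠ 0 := fun h => hr.ne' (hbij.1 (h.trans h0.symm))
  rw [hsq]
  exact mul_self_pos.2 hr0

/-- A scale-invariant mechanism with some nonzero score can be rescaled by any positive factor. -/
lemma ScaleInvariant.exists_scaling {M : AggregationMechanism} (h : M.ScaleInvariant)
    {m ℓ : ℕ} {u : Fin ℓ → Fin m → ℝ} {s : Finset (Fin m)} {x : Fin m} (hx : x ∈ s)
    (hne : M.agg u x s ≠ 0) {W : ℝ} (hW : 0 < W) :
    ∃ α : ℝ, ∀ (m ℓ : ℕ) (u : Fin ℓ → Fin m → ℝ) (s : Finset (Fin m)), ∀ x ∈ s,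
      M.agg (α • u) x s = W * M.agg u x s := by
  obtain ⟨Φ, hbij, hodd, hΦ⟩ := h
  obtain ⟨α, hα⟩ := hbij.2 W
  have hpos : 0 < α := by
    rcases lt_trichotomy α 0 with hneg | hz | hp
    · have h1 := ScaleInvariant.pos_factor hbij hodd hΦ hx hne (neg_pos.2 hneg)
      rw [hodd, hα] at h1
      linarith
    · have h1 := hodd 0
      rw [neg_zero] at h1
      rw [hz] at hα
      linarith
    · exact hp
  exact ⟨α, fun m ℓ u s x hx => hα ▸ hΦ α hpos m ℓ u s x hx⟩

/-- Concatenating families of scores, and padding by constant scores, adds up the differences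
between the aggregated scores of two items. -/
lemma exists_concat {X ι : Type*} [Fintype ι] {k ℓ : ℕ} (h : ι → Fin k → X → ℝ)
    (hℓ : Fintype.card ι * k ≤ ℓ) :
    ∃ f : Fin ℓ → X → ℝ, (∀ j, (∃ i a, f j = h i a) ∨ f j = fun _ => 0) ∧
      ∀ (x y : X) (s : Finset X),
        M.agg f x s - M.agg f y s = ∑ i, (M.agg (h i) x s - M.agg (h i) y s) := by
  obtain ⟨e⟩ : Nonempty (ι × Fin k ↪ Fin ℓ) :=
    Function.Embedding.nonempty_of_card_le (by simpa using hℓ)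
  refine ⟨Function.extend e (fun q => h q.1 q.2) (fun _ _ => 0), fun j => ?_, fun x y s => ?_⟩
  · by_cases hj : ∃ q, e q = j
    · obtain ⟨q, rfl⟩ := hj
      exact Or.inl ⟨q.1, q.2, e.injective.extend_apply _ _ q⟩
    · exact Or.inr (Function.extend_apply' _ _ j hj)
  · simp only [agg, ← Finset.sum_sub_distrib]
    rw [← Fintype.sum_prod_type']
    symm
    refine Fintype.sum_of_injective e e.injective _ _ (fun j hj => ?_) (fun q => ?_)
    · rw [Function.extend_apply' _ _ j (by simpa using hj), sub_self]
    · rw [e.injective.extend_apply]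

end AggregationMechanism

/-! ### Roles of items -/

/-- The role of an item relative to a set `s` and its chosen item `y`: chosen, rejected, or absent,
numbered as the items of a triple. -/
def itemRole {X : Type*} [DecidableEq X] (s : Finset X) (y x : X) : Fin 3 :=
  if x = y then 0 else if x ∈ s then 1 else 2

section itemRole

variable {X : Type*} [DecidableEq X]

lemma subset_of_image_itemRole {s t : Finset X} {y : X} (hy : y ∈ s)
    (h : t.image (itemRole s y) = {0, 1}) : t ⊆ s := by
  intro x hx
  have hmem : itemRole s y x ∈ ({0, 1} : Finset (Fin 3)) := h ▸ Finset.mem_image_of_mem _ hx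
  by_contra hxs
  have hxy : x ≠ y := fun e => hxs (e ▸ hy)
  simp [itemRole, hxs, hxy] at hmem

lemma image_itemRole_self {s : Finset X} {x y : X} (hy : y ∈ s) (hx : x ∈ s) (hxy : x ≠ y) :
    s.image (itemRole s y) = {0, 1} := by
  ext r
  simp only [Finset.mem_image, Finset.mem_insert, Finset.mem_singleton]
  constructor
  · rintro ⟨z, hz, rfl⟩
    by_cases hzy : z = y <;> simp [itemRole, hz, hzy]
  · rintro (rfl | rfl)
    · exact ⟨y, hy, by simp [itemRole]⟩
    · exact ⟨x, hx, by simp [itemRole, hx, hxy]⟩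

end itemRole

namespace AggregationMechanism

variable {M : AggregationMechanism} {X : Type*} [DecidableEq X] {k : ℕ} {u : Fin k → Fin 3 → ℝ}

/-- The utilities of a triple basis, assigned by the roles of the items relative to `s`, only
discriminate between items of subsets of `s`. -/
lemma IsTripleBasis.agg_itemRole_eq (hu : M.IsTripleBasis u) {s t : Finset X} {y x x' : X}
    (hy : y ∈ s) (hts : ¬ t ⊆ s) (hx : x ∈ t) (hx' : x' ∈ t) :
    M.agg u (itemRole s y x) (t.image (itemRole s y)) =
      M.agg u (itemRole s y x') (t.image (itemRole s y)) :=
  hu.2 _ (fun h => hts (subset_of_image_itemRole hy h)) _ (Finset.mem_image_of_mem _ hx) _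
    (Finset.mem_image_of_mem _ hx')

/-- The worst case is `x` rejected and `x'` chosen in a set with image `{0, 1}`; any other image
gives indifference. -/
lemma IsTripleBasis.agg_itemRole_ge (hu : M.IsTripleBasis u) {s t : Finset X} {y x x' : X}
    (hx : x ∈ t) (hx' : x' ∈ t) :
    -(M.agg u 0 {0, 1} - M.agg u 1 {0, 1}) ≤
      M.agg u (itemRole s y x) (t.image (itemRole s y)) -
        M.agg u (itemRole s y x') (t.image (itemRole s y)) := by
  have h1 := hu.1
  have hm := Finset.mem_image_of_mem (itemRole s y) hx
  have hm' := Finset.mem_image_of_mem (itemRole s y) hx'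
  by_cases h : t.image (itemRole s y) = {0, 1}
  · rw [h] at hm hm' ⊢
    simp only [Finset.mem_insert, Finset.mem_singleton] at hm hm'
    rcases hm with hm | hm <;> rcases hm' with hm' | hm' <;> rw [hm, hm'] <;> linarith
  · rw [hu.2 _ h _ hm _ hm']
    linarith

lemma agg_itemRole_self (M : AggregationMechanism) (u : Fin k → Fin 3 → ℝ) {s : Finset X}
    {x y : X} (hy : y ∈ s) (hx : x ∈ s) (hxy : x ≠ y) :
    M.agg u (itemRole s y y) (s.image (itemRole s y)) -
        M.agg u (itemRole s y x) (s.image (itemRole s y)) =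
      M.agg u 0 {0, 1} - M.agg u 1 {0, 1} := by
  rw [image_itemRole_self hy hx hxy]
  simp [itemRole, hx, hxy]

end AggregationMechanism

/-! ### Dominating weights and exact realization -/

/-- Positive weights for the choice sets such that the weight of each exceeds the total weight of
its proper supersets. -/
lemma exists_dominating_weight (X : Type*) [Fintype X] [DecidableEq X] (n : ℕ) :
    ∃ W : ChoiceSet X n → ℝ, (∀ s, 0 < W s) ∧
      ∀ t, ∑ s with t.1 ⊂ s.1, W s < W t := by
  set N : ℝ := (Fintype.card (ChoiceSet X n) : ℝ)
  have hN0 : 0 ≤ N := Nat.cast_nonneg _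
  -- An extra item costs a factor `N + 1`, while a set has at most `N` proper supersets.
  set W : ChoiceSet X n → ℝ := fun s => (N + 1) ^ (Fintype.card X - s.1.card)
  have hpos : ∀ s, 0 < W s := fun s => by positivity
  refine ⟨W, hpos, fun t => ?_⟩
  have hle : ∀ s ∈ Finset.univ.filter (fun s : ChoiceSet X n => t.1 ⊂ s.1),
      W s ≤ W t / (N + 1) := by
    intro s hs
    have hcard := Finset.card_lt_card (Finset.mem_filter.1 hs).2
    have hs' := Finset.card_le_univ s.1
    rw [le_div_iff₀ (by positivity)]
    simp only [W]
    rw [← pow_succ]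
    exact pow_le_pow_right₀ (by linarith) (by omega)
  have hpos' : 0 ≤ W t / (N + 1) := by have := hpos t; positivity
  calc ∑ s with t.1 ⊂ s.1, W s
      ≤ (Finset.univ.filter (fun s : ChoiceSet X n => t.1 ⊂ s.1)).card • (W t / (N + 1)) :=
        Finset.sum_le_card_nsmul _ _ _ hle
    _ ≤ N * (W t / (N + 1)) := by
        rw [nsmul_eq_mul]
        exact mul_le_mul_of_nonneg_right (Nat.cast_le.2 (Finset.card_le_univ _)) hpos'
    _ < W t := by
        rw [← mul_div_assoc, div_lt_iff₀ (by positivity)]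
        nlinarith [hpos t]

/-- Every choice function is realized with strict preferences by scores which, in each dimension,
only depend on the role of an item relative to one choice set. -/
lemma AggregationMechanism.IsTripleBasis.exists_realization {X : Type*} [Fintype X]
    [DecidableEq X] {n : ℕ} {M : AggregationMechanism} (hscale : M.ScaleInvariant) {k : ℕ}
    {u : Fin k → Fin 3 → ℝ} (hu : M.IsTripleBasis u) {ℓ : ℕ}
    (hℓ : Fintype.card (ChoiceSet X n) * k ≤ ℓ) (c : ChoiceSet X n → X) (hc : ∀ s, c s ∈ s.1) :
    ∃ f : Fin ℓ → X → ℝ,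
      (∀ j, (∃ (s : ChoiceSet X n) (v : Fin 3 → ℝ), f j = v ∘ itemRole s.1 (c s)) ∨
        f j = fun _ => 0) ∧
      ∀ (t : ChoiceSet X n), ∀ y ∈ t.1, y ≠ c t → M.agg f y t.1 < M.agg f (c t) t.1 := by
  obtain ⟨W, hWpos, hWdom⟩ := exists_dominating_weight X n
  have hne : ∃ r ∈ ({0, 1} : Finset (Fin 3)), M.agg u r {0, 1} ≠ 0 := by
    by_contra! h
    have h1 := hu.1
    rw [h 0 (by simp), h 1 (by simp)] at h1
    exact lt_irrefl _ h1
  obtain ⟨r, hr, hne⟩ := hne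
  choose α hα using fun s => hscale.exists_scaling hr hne (hWpos s)
  obtain ⟨f, hf, hagg⟩ :=
    M.exists_concat (fun s i => (α s • u) i ∘ itemRole s.1 (c s)) hℓ
  refine ⟨f, fun j => (hf j).imp_left fun ⟨s, i, h⟩ => ⟨s, _, h⟩, fun t y hy hyc => ?_⟩
  rw [← sub_pos, hagg]
  set δ := M.agg u 0 {0, 1} - M.agg u 1 {0, 1} with hδ
  have hδpos : 0 < δ := sub_pos.2 hu.1
  -- Worst-case contribution of block `s` on `t`: a gain if `s = t`, a possible loss if `t ⊂ s`, and
  -- nothing otherwise.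
  have hterm : ∀ s : ChoiceSet X n,
      (if s = t then W s * δ else 0) - (if t.1 ⊂ s.1 then W s * δ else 0) ≤
      M.agg (fun i => (α s • u) i ∘ itemRole s.1 (c s)) (c t) t.1 -
        M.agg (fun i => (α s • u) i ∘ itemRole s.1 (c s)) y t.1 := by
    intro s
    rw [M.agg_comp, M.agg_comp, hα s _ _ _ _ _ (Finset.mem_image_of_mem _ (hc t)),
      hα s _ _ _ _ _ (Finset.mem_image_of_mem _ hy), ← mul_sub]
    by_cases hst : s = t
    · subst hst
      rw [M.agg_itemRole_self u (hc s) hy hyc]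
      simp [hδ]
    · by_cases hsub : t.1 ⊆ s.1
      · have hss : t.1 ⊂ s.1 :=
          Finset.ssubset_iff_subset_ne.2 ⟨hsub, fun h => hst (Subtype.ext h.symm)⟩
        rw [if_neg hst, if_pos hss, zero_sub, ← mul_neg]
        exact mul_le_mul_of_nonneg_left (hu.agg_itemRole_ge (hc t) hy) (hWpos s).le
      · rw [if_neg hst, if_neg (fun h => hsub h.1), hu.agg_itemRole_eq (hc s) hsub (hc t) hy]
        simp
  refine lt_of_lt_of_le ?_ (Finset.sum_le_sum fun s _ => hterm s)
  rw [Finset.sum_sub_distrib, Finset.sum_ite_eq' Finset.univ t, if_pos (Finset.mem_univ t),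
    ← Finset.sum_filter, ← Finset.sum_mul, ← sub_mul]
  exact mul_pos (sub_pos.2 (hWdom t)) hδpos

/-! ### Risk -/

/-- A choice function realized with strict preferences has zero risk. -/
lemma risk_eq_zero {X : Type*} [Fintype X] {n : ℕ} {c : ChoiceSet X n → X} (hc : ∀ s, c s ∈ s.1)
    {D : PMF (ChoiceSet X n × X)} (hD : ∀ p ∈ D.support, p.2 = c p.1) {g : X → Finset X → ℝ}
    (hg : ∀ t : ChoiceSet X n, ∀ y ∈ t.1, y ≠ c t → g y t.1 < g (c t) t.1) : risk D g = 0 := by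
  refine Finset.sum_eq_zero fun p _ => ?_
  by_cases hp : p ∈ D.support
  · have hdec : decision g p.1.1 = {p.2} := by
      ext x
      rw [Set.mem_singleton_iff, hD p hp]
      constructor
      · rintro ⟨hx, hmax⟩
        by_contra hne
        exact (hg p.1 x hx hne).not_ge (hmax _ (hc p.1))
      · rintro rfl
        refine ⟨hc p.1, fun y hy => ?_⟩
        by_cases hyc : y = c p.1
        · rw [hyc]
        · exact (hg p.1 y hy hyc).le
    simp [zeroOneLoss, hdec]
  · rw [PMF.mem_support_iff, not_not] at hp
    simp [hp]

lemma risk_nonneg {X : Type*} [Fintype X] {n : ℕ} (D : PMF (ChoiceSet X n × X))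
    (g : X → Finset X → ℝ) : 0 ≤ risk D g := by
  refine Finset.sum_nonneg fun p _ => mul_nonneg ENNReal.toReal_nonneg ?_
  unfold zeroOneLoss
  split_ifs <;> norm_num

lemma approxError_eq_zero {X : Type*} [Fintype X] {n : ℕ} {D : PMF (ChoiceSet X n × X)}
    {G : Set (X → Finset X → ℝ)} {g : X → Finset X → ℝ} (hg : g ∈ G) (h : risk D g = 0) :
    approxError D G = 0 :=
  IsLeast.csInf_eq ⟨⟨g, hg, h⟩, by rintro _ ⟨g', -, rfl⟩; exact risk_nonneg D g'⟩

/-! ### Continuity and approximation by networks -/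

/-- The aggregated scores of a continuous mechanism are continuous over any finite set of items. -/
lemma AggregationMechanism.ContinuousInUtilities.continuous_agg {X : Type*} [Fintype X]
    {M : AggregationMechanism} (hM : M.ContinuousInUtilities) {ℓ : ℕ} {s : Finset X} {x : X}
    (hx : x ∈ s) : Continuous fun f : Fin ℓ → X → ℝ => M.agg f x s := by
  let e := Fintype.equivFin X
  have h := hM (Fintype.card X) ℓ (s.image e) (e x) (Finset.mem_image_of_mem _ hx)
  have hcomp : Continuous fun (f : Fin ℓ → X → ℝ) (i : Fin ℓ) => f i ∘ e.symm := by
    refine continuous_pi fun i => continuous_pi fun j => ?_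
    exact (continuous_apply (e.symm j)).comp (continuous_apply i)
  refine (h.comp hcomp).congr fun f => ?_
  rw [Function.comp_apply, ← M.agg_comp (fun i => f i ∘ e.symm) e]
  simp [Function.comp_assoc]

/-- A sigmoidal activation of increasing slope, applied to inputs eventually on one side of the
threshold. -/
lemma IsSigmoidal.tendsto_comp_mul {σ : ℝ → ℝ} (hσ : IsSigmoidal σ) {z : ℕ → ℝ} {a θ : ℝ}
    (hz : Tendsto z atTop (𝓝 a)) (ha : a ≠ θ) :
    Tendsto (fun m : ℕ => σ (m * (z m - θ))) atTop (𝓝 (if θ < a then 1 else 0)) := by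
  have hsub : Tendsto (fun m => z m - θ) atTop (𝓝 (a - θ)) := hz.sub_const θ
  split_ifs with h
  · exact hσ.2.comp ((tendsto_natCast_atTop_atTop (R := ℝ)).atTop_mul_pos (sub_pos.2 h) hsub)
  · exact hσ.1.comp ((tendsto_natCast_atTop_atTop (R := ℝ)).atTop_mul_neg
      (sub_neg.2 (lt_of_le_of_ne (not_lt.1 h) ha)) hsub)

/-- A separating score function has a threshold between a set and its complement. -/
lemma Separates.exists_threshold {X : Type*} [Fintype X] {f : X → ℝ} {s : Finset X}
    (h : Separates f s) : ∃ θ : ℝ, (∀ x ∈ s, θ < f x) ∧ ∀ x ∉ s, f x < θ := by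
  classical
  obtain ⟨θ, hlo, hhi⟩ := Order.exists_between_finsets (sᶜ.image f) (s.image f) (by
    intro a ha b hb
    obtain ⟨x', hx', rfl⟩ := Finset.mem_image.1 ha
    obtain ⟨x, hx, rfl⟩ := Finset.mem_image.1 hb
    exact h x hx x' (Finset.mem_compl.1 hx'))
  exact ⟨θ, fun x hx => hhi _ (Finset.mem_image_of_mem _ hx),
    fun x hx => hlo _ (Finset.mem_image_of_mem _ (Finset.mem_compl.2 hx))⟩

/-- The scores depending only on the role of an item relative to a set `s` are limits of small
networks fed with separators of the chosen item and of `s`. -/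
lemma exists_tendsto_enrichedClass {X : Type*} [Fintype X] [DecidableEq X] {σ : ℝ → ℝ}
    (hσ : IsSigmoidal σ) {F : Set (X → ℝ)} {s : Finset X} {y : X} (hy : y ∈ s) {b b' : X → ℝ}
    (hb : b ∈ F) (hb' : b' ∈ F) (hsep : Separates b {y}) (hsep' : Separates b' s)
    (v : Fin 3 → ℝ) :
    ∃ f : ℕ → X → ℝ, (∀ m, f m ∈ enrichedClass σ F) ∧
      Tendsto f atTop (𝓝 (v ∘ itemRole s y)) := by
  obtain ⟨θ, hθ, hθn⟩ := hsep.exists_threshold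
  obtain ⟨θ', hθ', hθn'⟩ := hsep'.exists_threshold
  -- Diagonal layers keep the two inputs apart: thresholds `θ`, `θ'`, then `1 / 2`. In the limit the
  -- units are the indicators of `x = y` and `x ∈ s`; since `y ∈ s`, the affine output telescopes to
  -- `v` at the role.
  let A : ℕ → Matrix (Fin 2) (Fin 2) ℝ := fun m => Matrix.diagonal fun _ => (m : ℝ)
  refine ⟨fun m x => smallNet σ (A m) ![-(m * θ), -(m * θ')] (A m)
      ![-(m * (1 / 2)), -(m * (1 / 2))] ![v 0 - v 1, v 1 - v 2] (v 2) ![b x, b' x],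
    fun m => ⟨_, _, _, _, _, _, b, hb, b', hb', rfl⟩, tendsto_pi_nhds.2 fun x => ?_⟩
  have hlayers : ∀ (z θ : ℝ), z ≠ θ → Tendsto (fun m : ℕ => σ (m * (σ (m * (z - θ)) - 1 / 2)))
      atTop (𝓝 (if θ < z then 1 else 0)) := by
    intro z θ hz
    have h := hσ.tendsto_comp_mul (hσ.tendsto_comp_mul (tendsto_const_nhds (x := z)) hz)
      (θ := 1 / 2) (by split_ifs <;> norm_num)
    convert h using 2
    split_ifs <;> norm_num at *
  have hne : b x ≠ θ := by
    by_cases hx : x = y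
    · exact (hθ x (by simp [hx])).ne'
    · exact (hθn x (by simp [hx])).ne
  have hne' : b' x ≠ θ' := by
    by_cases hx : x ∈ s
    · exact (hθ' x hx).ne'
    · exact (hθn' x hx).ne
  have hiff : θ < b x ↔ x = y := by
    refine ⟨fun h => ?_, fun h => hθ x (by simp [h])⟩
    by_contra hx
    exact (hθn x (by simp [hx])).not_gt h
  have hiff' : θ' < b' x ↔ x ∈ s := by
    refine ⟨fun h => ?_, hθ' x⟩
    by_contra hx
    exact (hθn' x hx).not_gt h
  have hlim := (((hlayers _ _ hne).const_mul (v 0 - v 1)).add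
    ((hlayers _ _ hne').const_mul (v 1 - v 2))).add_const (v 2)
  convert hlim using 2
  · simp only [smallNet, A, dotProduct, Fin.sum_univ_two, Matrix.mulVec_diagonal, Pi.add_apply,
      Matrix.cons_val_zero, Matrix.cons_val_one, sub_eq_add_neg, mul_add, mul_neg]
  · simp only [hiff, hiff', Function.comp_apply, itemRole]
    by_cases hx : x = y
    · simp [hx, hy]
    · by_cases hxs : x ∈ s <;> simp [hx, hxs]

lemma zero_mem_enrichedClass {X : Type*} (σ : ℝ → ℝ) {F : Set (X → ℝ)} {b : X → ℝ} (hb : b ∈ F) :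
    (fun _ => 0) ∈ enrichedClass σ F :=
  ⟨0, 0, 0, 0, 0, 0, b, hb, b, hb, by simp [smallNet]⟩

/-- The strict preferences of a choice function are kept by nearby scores. -/
lemma AggregationMechanism.ContinuousInUtilities.eventually_realization {X : Type*} [Fintype X]
    {M : AggregationMechanism} (hM : M.ContinuousInUtilities) {n ℓ : ℕ} {c : ChoiceSet X n → X}
    (hc : ∀ s, c s ∈ s.1) {f : Fin ℓ → X → ℝ}
    (hf : ∀ t : ChoiceSet X n, ∀ y ∈ t.1, y ≠ c t → M.agg f y t.1 < M.agg f (c t) t.1) :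
    ∀ᶠ f' in 𝓝 f, ∀ t : ChoiceSet X n, ∀ y ∈ t.1, y ≠ c t →
      M.agg f' y t.1 < M.agg f' (c t) t.1 := by
  refine eventually_all.2 fun t => eventually_all.2 fun y => ?_
  by_cases hy : y ∈ t.1 ∧ y ≠ c t
  · filter_upwards [(hM.continuous_agg hy.1).continuousAt.eventually_lt
      (hM.continuous_agg (hc t)).continuousAt (hf t y hy.1 hy.2)] with f' hf' _ _ using hf'
  · exact Eventually.of_forall fun f' h1 h2 => absurd ⟨h1, h2⟩ hy

theorem mainTheorem2 {X : Type*} [Fintype X] (n : ℕ)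
    (M : AggregationMechanism) (hscale : M.ScaleInvariant)
    {k : ℕ} (u : Fin k → Fin 3 → ℝ) (hu : M.IsTripleBasis u) :
    ∃ ℓ₀ : ℕ, ∀ ℓ : ℕ, ℓ₀ ≤ ℓ →
      ∀ c : ChoiceSet X n → X, (∀ s, c s ∈ s.1) →
      ∀ D : PMF (ChoiceSet X n × X), (∀ p ∈ D.support, p.2 = c p.1) →
        (approxError D (M.aggClass ℓ Set.univ) = 0 ∧
          ∃ g ∈ M.aggClass ℓ Set.univ, risk D g = 0) ∧
        (M.ContinuousInUtilities →
          ∀ σ : ℝ → ℝ, IsSigmoidal σ →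
          ∀ F : Set (X → ℝ), SeparatesChoiceSets F n →
          ∀ H : Set (X → ℝ), enrichedClass σ F ⊆ H →
            approxError D (M.aggClass ℓ H) = 0 ∧ ∃ g ∈ M.aggClass ℓ H, risk D g = 0) := by
  classical
  refine ⟨Fintype.card (ChoiceSet X n) * k, fun ℓ hℓ c hc D hD => ?_⟩
  obtain ⟨f, hf, hfc⟩ := hu.exists_realization hscale hℓ c hc
  have hmain : ∀ (H : Set (X → ℝ)) (f : Fin ℓ → X → ℝ), (∀ j, f j ∈ H) →
      (∀ t : ChoiceSet X n, ∀ y ∈ t.1, y ≠ c t → M.agg f y t.1 < M.agg f (c t) t.1) →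
      approxError D (M.aggClass ℓ H) = 0 ∧ ∃ g ∈ M.aggClass ℓ H, risk D g = 0 := by
    intro H f hfH hfc
    have hmem : M.agg f ∈ M.aggClass ℓ H := ⟨f, hfH, rfl⟩
    have hrisk : risk D (M.agg f) = 0 := risk_eq_zero hc hD hfc
    exact ⟨approxError_eq_zero hmem hrisk, _, hmem, hrisk⟩
  refine ⟨hmain _ f (fun _ => Set.mem_univ _) hfc, fun hM σ hσ F hF H hH => ?_⟩
  have happrox : ∀ j, ∃ f' : ℕ → X → ℝ, (∀ m, f' m ∈ enrichedClass σ F) ∧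
      Tendsto f' atTop (𝓝 (f j)) := by
    intro j
    rcases hf j with ⟨s, v, hj⟩ | hj
    -- The singleton is a choice set: `1 ≤ n` because `s` is nonempty with at most `n` items.
    · obtain ⟨b, hb, hsep⟩ := hF ⟨{c s}, by simp, by
        rw [Finset.card_singleton]
        exact (Finset.card_pos.2 s.2.1).trans_le s.2.2⟩
      obtain ⟨b', hb', hsep'⟩ := hF s
      rw [hj]
      exact exists_tendsto_enrichedClass hσ (hc s) hb hb' hsep hsep' v
    -- The support of `D` supplies a choice set, hence a member of `F` from which to build the zero
    -- network.
    · obtain ⟨p, -⟩ := D.support_nonempty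
      obtain ⟨b, hb, -⟩ := hF p.1
      exact ⟨fun _ => f j, fun _ => hj ▸ zero_mem_enrichedClass σ hb, tendsto_const_nhds⟩
  choose f' hf' hlim using happrox
  have htendsto : Tendsto (fun m j => f' j m) atTop (𝓝 f) := tendsto_pi_nhds.2 hlim
  obtain ⟨m, hm⟩ := (htendsto.eventually (hM.eventually_realization hc hfc)).exists
  exact hmain H (fun j => f' j m) (fun j => hH (hf' j m)) hm
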